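/- Let $n\in\{1,2,3\}$, let $\Omega\subset\mathbb R^n$ be a bounded domain with smooth boundary and outward unit normal $\nu$, and let $0\le T_0<T$. Let $f=\chi_D\,\rho$, where $D\subset\overline\Omega\times[T_0,T]$ is Lebesgue measurable and $\rho$ is a real-valued, essentially bounded function on $D$. Suppose that there are $0<\delta<T-T_0$, $C_1>0$, $C_2>0$ and $p\ge 0$ such that the $n$-dimensional Lebesgue measure of the cross-section $D(s)=\{x : (x,T_0+s)\in D\}$ satisfies $|D(s)|\ge C_1s^p$ for almost all $s\in[0,\delta]$, and such that either $\rho\ge C_2$ almost everywhere on $D\cap(\mathbb R^n\times[T_0,T_0+\delta])$, or $-\rho\ge C_2$ almost everywhere on that set. Let $u\in C([0,T];L^2(\Omega))\cap L^2(0,T;H^1(\Omega))$ be a weak solution of $$u_t=\Delta u+f\ \text{ in }\Omega\times(0,T),\qquad u(\cdot,0)=0\ \text{ in }\Omega ,$$ whose trace $u|_{\partial\Omega\times(0,T)}$ and weak normal derivative $\partial u/\partial\nu|_{\partial\Omega\times(0,T)}$ are integrable functions on $\partial\Omega\times(0,T)$. (No boundary condition is imposed: $h=\partial u/\partial\nu$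 means that $\int_\Omega u(t)\varphi(t)\,dx+\int_0^t\!\int_\Omega(\nabla u\cdot\nabla\varphi-u\,\varphi_t)\,dx\,dr=\int_0^t\!\int_\Omega f\varphi\,dx\,dr+\int_0^t\!\int_{\partial\Omega}h\varphi\,dS\,dr$ for all $\varphi\in C^\infty(\mathbb R^n\times\mathbb R)$ and all $t\in[0,T]$.) For a unit vector $\omega\in\mathbb R^n$, $s\in\mathbb R$ and $\tau>0$ put $v(x,t)=e^{\sqrt\tau\,x\cdot\omega-\tau t}$ and $$I_\omega(\tau;s)=e^{\tau s}\int_0^T\!\int_{\partial\Omega}\Big(\frac{\partial v}{\partial\nu}\,u-\frac{\partial u}{\partial\nu}\,v\Big)\,dS\,dt .$$ Then $I_\omega(\tau;0)\ne0$ for all sufficiently large $\tau$, and $$\lim_{\tau\to\infty}\frac{\log|I_\omega(\tau;0)|}{\tau}=-T_0 .$$ Moreover, $\lim_{\tau\to\infty}|I_\omega(\tau;s)|=0$ if $s<T_0$, and $\lim_{\tau\to\infty}|I_\omega(\tau;s)|=\infty$ if $s>T_0$. -/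

import Mathlib

open MeasureTheory Set Filter Topology
open scoped ENNReal

namespace HeatSource

noncomputable section

/-- The space `ℝⁿ` with its Euclidean norm. Points of space-time are pairs `(x, t)`. -/
abbrev Space (n : ℕ) : Type := EuclideanSpace ℝ (Fin n)

/-- `ψ` is a smooth defining function of `Ω` near `x`: `Ω = {ψ < 0}` near `x` and `∇ψ(x) ≠ 0`. -/
def IsDefiningFunctionAt {n : ℕ} (Ω : Set (Space n)) (x : Space n) (ψ : Space n → ℝ) : Prop :=
  ContDiff ℝ (⊤ : ℕ∞) ψ ∧ gradient ψ x ≠ 0 ∧ ∀ᶠ y in 𝓝 x, (y ∈ Ω ↔ ψ y < 0)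

/-- A bounded domain of `ℝⁿ` with smooth boundary. -/
structure IsSmoothBoundedDomain {n : ℕ} (Ω : Set (Space n)) : Prop where
  isOpen : IsOpen Ω
  isConnected : IsConnected Ω
  isBounded : Bornology.IsBounded Ω
  smooth_boundary : ∀ x ∈ frontier Ω, ∃ ψ : Space n → ℝ, IsDefiningFunctionAt Ω x ψ

open Classical in
/-- The outward unit normal `ν(x) = ∇ψ(x) / |∇ψ(x)|` at a boundary point `x` of a domain with smooth
boundary. The vector does not depend on the defining function `ψ` that is chosen. -/
def outwardNormal {n : ℕ} (Ω : Set (Space n)) (x : Space n) : Space n :=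
  if h : ∃ ψ : Space n → ℝ, IsDefiningFunctionAt Ω x ψ then
    ‖gradient h.choose x‖⁻¹ • gradient h.choose x
  else 0

/-- The surface measure `dS` on `∂Ω`: the `(n-1)`-dimensional Hausdorff measure, in the
normalization that agrees with Lebesgue measure on `(n-1)`-dimensional planes
(for `n = 1`, counting measure on the end points). -/
def surfaceMeasure {n : ℕ} (Ω : Set (Space n)) : Measure (Space n) :=
  (Measure.euclideanHausdorffMeasure (n - 1) : Measure (Space n)).restrict (frontier Ω)

/-- The measure `dS dt` on the lateral boundary `∂Ω × ]0, T[`. -/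
def lateralMeasure {n : ℕ} (Ω : Set (Space n)) (T : ℝ) : Measure (Space n × ℝ) :=
  (surfaceMeasure Ω).prod (volume.restrict (Ioo 0 T))

/-- The cylinder `Ω × ]0, T[`. -/
def cylinder {n : ℕ} (Ω : Set (Space n)) (T : ℝ) : Set (Space n × ℝ) := Ω ×ˢ Ioo 0 T

/-- The gradient in the space variable of a function on space-time. -/
def gradX {n : ℕ} (φ : Space n × ℝ → ℝ) (z : Space n × ℝ) : Space n :=
  gradient (fun y => φ (y, z.2)) z.1

/-- The divergence in the space variable of a vector field on space-time. -/
def divX {n : ℕ} (Φ : Space n × ℝ → Space n) (z : Space n × ℝ) : ℝ :=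
  ∑ i, (fderiv ℝ (fun y => Φ (y, z.2)) z.1 (EuclideanSpace.single i 1)) i

/-- The time derivative of a function on space-time. -/
def dtime {n : ℕ} (φ : Space n × ℝ → ℝ) (z : Space n × ℝ) : ℝ :=
  deriv (fun r => φ (z.1, r)) z.2

/-- `Du` is the weak spatial gradient of `u` in `Ω × ]0, T[`. -/
def IsWeakSpatialGradient {n : ℕ} (Ω : Set (Space n)) (T : ℝ) (u : Space n × ℝ → ℝ)
    (Du : Space n × ℝ → Space n) : Prop :=
  ∀ Φ : Space n × ℝ → Space n, ContDiff ℝ (⊤ : ℕ∞) Φ → HasCompactSupport Φ →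
    tsupport Φ ⊆ cylinder Ω T →
    ∫ z in cylinder Ω T, inner ℝ (Du z) (Φ z) = - ∫ z in cylinder Ω T, u z * divX Φ z

/-- `g` is the trace on `∂Ω × ]0, T[` of the function `u` with weak spatial gradient `Du`, in the
sense of the Gauss-Green formula against all vector fields that are smooth up to the boundary.
This determines `g` almost everywhere with respect to `dS dt`. -/
def IsLateralTrace {n : ℕ} (Ω : Set (Space n)) (T : ℝ) (u : Space n × ℝ → ℝ)
    (Du : Space n × ℝ → Space n) (g : Space n × ℝ → ℝ) : Prop :=
  ∀ Φ : Space n × ℝ → Space n, ContDiff ℝ (⊤ : ℕ∞) Φ →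
    ∫ z, g z * inner ℝ (Φ z) (outwardNormal Ω z.1) ∂(lateralMeasure Ω T) =
      ∫ z in cylinder Ω T, (u z * divX Φ z + inner ℝ (Du z) (Φ z))

/-- `u` is a weak solution, in the energy class `C([0,T]; L²(Ω)) ∩ L²(0,T; H¹(Ω))`, of
`u_t = Δu + f` in `Ω × ]0, T[` with `u(·, 0) = 0`, whose lateral Cauchy data
`u = g` and `∂u/∂ν = h` on `∂Ω × ]0, T[` are integrable with respect to `dS dt`. -/
structure IsWeakSolution {n : ℕ} (Ω : Set (Space n)) (T : ℝ) (f u g h : Space n × ℝ → ℝ) :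
    Prop where
  memLp_time : ∀ t ∈ Icc (0 : ℝ) T, MemLp (fun x => u (x, t)) 2 (volume.restrict Ω)
  continuous_time : ∀ t ∈ Icc (0 : ℝ) T,
    Tendsto (fun r => eLpNorm (fun x => u (x, r) - u (x, t)) 2 (volume.restrict Ω))
      (𝓝[Icc 0 T] t) (𝓝 0)
  initial : ∀ᵐ x ∂(volume.restrict Ω), u (x, 0) = 0
  memLp : MemLp u 2 (volume.restrict (cylinder Ω T))
  integrable_trace : Integrable g (lateralMeasure Ω T)
  integrable_normal : Integrable h (lateralMeasure Ω T)
  weak_form : ∃ Du : Space n × ℝ → Space n,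
    MemLp Du 2 (volume.restrict (cylinder Ω T)) ∧
    IsWeakSpatialGradient Ω T u Du ∧
    IsLateralTrace Ω T u Du g ∧
    ∀ φ : Space n × ℝ → ℝ, ContDiff ℝ (⊤ : ℕ∞) φ → ∀ t ∈ Icc (0 : ℝ) T,
      (∫ x in Ω, u (x, t) * φ (x, t)) +
          ∫ z in cylinder Ω t, (inner ℝ (Du z) (gradX φ z) - u z * dtime φ z) =
        (∫ z in cylinder Ω t, f z * φ z) + ∫ z, h z * φ z ∂(lateralMeasure Ω t)

/-- The solution `v(x,t) = exp(√τ x·ω - τ t)` of the backward heat equation. -/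
def backwardWave {n : ℕ} (ω : Space n) (τ : ℝ) (z : Space n × ℝ) : ℝ :=
  Real.exp (Real.sqrt τ * inner ℝ z.1 ω - τ * z.2)

/-- The indicator function
`I_ω(τ; s) = e^{τ s} ∫_0^T ∫_{∂Ω} (∂v/∂ν u - ∂u/∂ν v) dS dt`,
computed from the lateral Cauchy data `g = u` and `h = ∂u/∂ν`. -/
def indicatorFunction {n : ℕ} (Ω : Set (Space n)) (T : ℝ) (g h : Space n × ℝ → ℝ)
    (ω : Space n) (τ s : ℝ) : ℝ :=
  Real.exp (τ * s) *
    ∫ z, (inner ℝ (gradX (backwardWave ω τ) z) (outwardNormal Ω z.1) * g z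
      - h z * backwardWave ω τ z) ∂(lateralMeasure Ω T)

end

end HeatSource

/-! ### The boundary is a null set and the normal is continuous along it. -/

namespace HeatSource

variable {n : ℕ} {Ω : Set (Space n)} {x : Space n} {ψ ψ' : Space n → ℝ}

/-! The wave `v` solves the backward heat equation `v_t + Δv = 0`. Testing the weak form with `v`
and the trace formula with `∇v` therefore removes all interior terms in `u`, leaving `I(τ;0) = ∫ f v
- ∫ u(T) v(T)` (`IsWeakSolution.indicatorFunction_zero`).

If `‖x‖ ≤ R` on `Ω`, the spatial factor of `v` lies between `e^{-√τ R}` and `e^{√τ R}`, which is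
negligible on the scale `e^{cτ}`; only the times at which `f` acts matter. Since `f` vanishes before
`T₀`, `|I| ≤ A e^{√τ R - τ T₀}`. Conversely, for fixed `ε < δ`, the source on `[T₀, T₀+ε]` has one
sign, is bounded below, and lives on a set of positive measure, so it contributes at least `a e^{-√τ
R - τ(T₀+ε)}`. Cancellation can come only from the source after `T₀+δ` and from the final time `T >
T₀+δ`, both `O(e^{√τ R - τ(T₀+δ)})`. Taking `τ → ∞` and then `ε → 0` gives the rate
(`tendsto_log_abs_div_of_exp_bounds`). As `ε` is fixed while `τ → ∞`, the power `s^p` enters only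
through its positivity. -/

theorem IsDefiningFunctionAt.hasStrictFDerivAt (h : IsDefiningFunctionAt Ω x ψ) :
    HasStrictFDerivAt ψ (innerSL ℝ (gradient ψ x)) x := by
  have h1 := h.1.contDiffAt (x := x).hasStrictFDerivAt (by simp)
  have h2 : innerSL ℝ (gradient ψ x) = fderiv ℝ ψ x := by
    ext w
    simp
  rwa [h2]

theorem continuous_gradient (h : ContDiff ℝ (⊤ : ℕ∞) ψ) : Continuous (gradient ψ) :=
  (InnerProductSpace.toDual ℝ (Space n)).symm.continuous.comp (h.continuous_fderiv (by simp))

/-- A defining function at `x` is one at all points near `x`. -/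
theorem IsDefiningFunctionAt.eventually (h : IsDefiningFunctionAt Ω x ψ) :
    ∀ᶠ y in 𝓝 x, IsDefiningFunctionAt Ω y ψ := by
  have h1 := (continuous_gradient h.1).continuousAt.eventually_ne h.2.1
  filter_upwards [h1, h.2.2.eventually_nhds] with y hy hy'
  exact ⟨h.1, hy, hy'⟩

theorem IsDefiningFunctionAt.eq_zero (hΩ : IsOpen Ω) (h : IsDefiningFunctionAt Ω x ψ)
    (hx : x ∈ frontier Ω) : ψ x = 0 := by
  apply le_antisymm
  · have h1 : ∃ᶠ y in 𝓝 x, y ∈ Ω := mem_closure_iff_frequently.1 hx.1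
    have h2 : ∃ᶠ y in 𝓝 x, ψ y ≤ 0 :=
      (h1.and_eventually h.2.2).mono fun y hy => (hy.2.1 hy.1).le
    have : x ∈ closure {y | ψ y ≤ 0} := mem_closure_iff_frequently.2 h2
    rwa [(isClosed_le h.1.continuous continuous_const).closure_eq] at this
  · have : x ∉ Ω := by rw [hΩ.frontier_eq] at hx; exact hx.2
    rw [h.2.2.self_of_nhds] at this
    exact not_lt.1 this

theorem IsDefiningFunctionAt.eventually_eq_zero (hΩ : IsOpen Ω)
    (h : IsDefiningFunctionAt Ω x ψ) : ∀ᶠ y in 𝓝 x, y ∈ frontier Ω → ψ y = 0 := by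
  filter_upwards [h.eventually] with y hy hyf using hy.eq_zero hΩ hyf

/-- The part of the boundary near a boundary point is a null set, since its translates in the
normal direction are disjoint. -/
theorem exists_nhds_volume_frontier_inter_eq_zero (hΩ : IsOpen Ω)
    (h : IsDefiningFunctionAt Ω x ψ) : ∃ U ∈ 𝓝 x, volume (frontier Ω ∩ U) = 0 := by
  set a := gradient ψ x with ha
  have ha0 : 0 < ‖a‖ := norm_pos_iff.2 h.2.1
  -- With tolerance `‖a‖ / 2`, two zeros of `ψ` near `x` differing by `c • a` would satisfy `|c|
  -- ‖a‖² ≤ |c| ‖a‖² / 2`, so `c = 0`: translates along `a` are disjoint.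
  have hs := h.hasStrictFDerivAt.isLittleO.def (half_pos ha0)
  rw [nhds_prod_eq, ← ha] at hs
  obtain ⟨V, hV, hVs⟩ := Filter.eventually_prod_self_iff (r := fun y z =>
    ‖ψ y - ψ z - innerSL ℝ a (y - z)‖ ≤ ‖a‖ / 2 * ‖y - z‖).1 hs
  obtain ⟨U, hUs, hUo, hxU⟩ :=
    mem_nhds_iff.1 (inter_mem hV (h.eventually_eq_zero hΩ))
  refine ⟨U, hUo.mem_nhds hxU, ?_⟩
  refine Measure.addHaar_eq_zero_of_disjoint_translates volume
    (fun k : ℕ => (1 / ((k : ℝ) + 1)) • a) ?_ ?_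
    (isClosed_frontier.measurableSet.inter hUo.measurableSet)
  · exact Metric.isBounded_range_of_tendsto _
      (tendsto_one_div_add_atTop_nhds_zero_nat.smul_const a)
  · intro i j hij
    refine Set.disjoint_left.2 ?_
    rintro v ⟨_, rfl, y, hy, rfl⟩ ⟨_, rfl, z, hz, hyz⟩
    have hy0 : ψ y = 0 := (hUs hy.2).2 hy.1
    have hz0 : ψ z = 0 := (hUs hz.2).2 hz.1
    have hle := hVs y (hUs hy.2).1 z (hUs hz.2).1
    simp only at hyz
    set c : ℝ := 1 / ((j : ℝ) + 1) - 1 / ((i : ℝ) + 1) with hc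
    have hyzc : y - z = c • a := by
      rw [hc, sub_smul, sub_eq_sub_iff_add_eq_add, add_comm y, ← hyz, add_comm]
    have hc0 : c ≠ 0 := by
      intro h0
      have := sub_eq_zero.1 (hc ▸ h0)
      rw [one_div, one_div, inv_inj, add_left_inj, Nat.cast_inj] at this
      exact hij this.symm
    simp only [hyzc, hy0, hz0, sub_self, zero_sub, norm_neg, innerSL_apply_apply,
      inner_smul_right, real_inner_self_eq_norm_sq, norm_mul, norm_smul, norm_pow, norm_norm] at hle
    have hcp : 0 < ‖c‖ := norm_pos_iff.2 hc0
    have : 0 < ‖c‖ * ‖a‖ ^ 2 := by positivity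
    nlinarith

/-- The boundary of a smooth domain is a null set. -/
theorem IsSmoothBoundedDomain.volume_frontier (hΩ : IsSmoothBoundedDomain Ω) :
    volume (frontier Ω) = 0 := by
  refine measure_null_of_locally_null _ fun x hx => ?_
  obtain ⟨ψ, hψ⟩ := hΩ.smooth_boundary x hx
  obtain ⟨U, hU, hU0⟩ := exists_nhds_volume_frontier_inter_eq_zero hΩ.isOpen hψ
  exact ⟨frontier Ω ∩ U, inter_mem self_mem_nhdsWithin (mem_nhdsWithin_of_mem_nhds hU), hU0⟩

/-- Directions in which one defining function decreases are not directions of increase of another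
one. -/
theorem IsDefiningFunctionAt.inner_gradient_nonpos (h : IsDefiningFunctionAt Ω x ψ)
    (h' : IsDefiningFunctionAt Ω x ψ') (h0 : ψ x = 0) (h0' : ψ' x = 0) {w : Space n}
    (hw : inner ℝ (gradient ψ x) w < 0) : inner ℝ (gradient ψ' x) w ≤ 0 := by
  have key : ∀ {χ : Space n → ℝ}, IsDefiningFunctionAt Ω x χ →
      HasDerivAt (fun t : ℝ => χ (x + t • w)) (inner ℝ (gradient χ x) w) 0 := by
    intro χ hχ
    have h1 : HasFDerivAt χ (innerSL ℝ (gradient χ x)) (x + (0 : ℝ) • w) := by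
      simpa using hχ.hasStrictFDerivAt.hasFDerivAt
    have h2 : HasDerivAt (fun t : ℝ => x + t • w) w 0 := by
      simpa using ((hasDerivAt_id (0 : ℝ)).smul_const w).const_add x
    exact h1.comp_hasDerivAt (0 : ℝ) h2
  by_contra! hpos
  -- For small `t > 0` the point `x + t • w` has `ψ < 0`, hence lies in `Ω`, hence has `ψ' < 0`; so
  -- `ψ'` cannot increase along `w`.
  have hlim : Tendsto (fun t : ℝ => x + t • w) (𝓝[>] 0) (𝓝 x) := by
    have : Continuous fun t : ℝ => x + t • w := by fun_prop
    simpa using (this.tendsto 0).mono_left nhdsWithin_le_nhds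
  have s1 := ((key h).tendsto_slope_zero_right).eventually_lt_const hw
  have s2 := ((key h').tendsto_slope_zero_right).eventually_const_lt hpos
  obtain ⟨t, t1, t2, t3, t4, t5⟩ := (s1.and (s2.and ((hlim.eventually h.2.2).and
    ((hlim.eventually h'.2.2).and self_mem_nhdsWithin)))).exists
  have ht : 0 < t := t5
  simp only [zero_add, zero_smul, add_zero, h0, h0', sub_zero, smul_eq_mul] at t1 t2
  have e1 : ψ (x + t • w) < 0 := by
    by_contra! hh
    exact absurd t1 (not_lt.2 (mul_nonneg (inv_nonneg.2 ht.le) hh))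
  have e2 : ψ' (x + t • w) < 0 := t4.1 (t3.2 e1)
  exact absurd t2 (not_lt.2 (mul_nonpos_of_nonneg_of_nonpos (inv_nonneg.2 ht.le) e2.le))

/-- The normalized gradient does not depend on the defining function. -/
theorem IsDefiningFunctionAt.normalized_gradient_eq (h : IsDefiningFunctionAt Ω x ψ)
    (h' : IsDefiningFunctionAt Ω x ψ') (h0 : ψ x = 0) (h0' : ψ' x = 0) :
    ‖gradient ψ x‖⁻¹ • gradient ψ x = ‖gradient ψ' x‖⁻¹ • gradient ψ' x := by
  have key := fun w => h.inner_gradient_nonpos h' h0 h0' (w := w)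
  have ha0 := h.2.1
  have hb0 := h'.2.1
  generalize gradient ψ x = a at *
  generalize gradient ψ' x = b at *
  have haa : 0 < inner ℝ a a := real_inner_self_pos.2 ha0
  -- The open half-space of `a` passes to its closure by perturbing `w` to `w - t • a`. Testing with
  -- the part of `b` orthogonal to `a` then shows that it vanishes, and testing with `-a` gives the
  -- sign of the factor.
  have key' : ∀ w, inner ℝ a w ≤ 0 → inner ℝ b w ≤ 0 := by
    intro w hw
    have hlim : Tendsto (fun t : ℝ => inner ℝ b (w - t • a)) (𝓝[>] 0) (𝓝 (inner ℝ b w)) := by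
      have : Continuous fun t : ℝ => inner ℝ b (w - t • a) := by fun_prop
      simpa using (this.tendsto 0).mono_left nhdsWithin_le_nhds
    refine le_of_tendsto hlim ?_
    filter_upwards [self_mem_nhdsWithin] with t ht
    refine key _ ?_
    rw [inner_sub_right, inner_smul_right]
    have := mul_pos (mem_Ioi.1 ht) haa
    linarith
  set c : ℝ := inner ℝ a b / inner ℝ a a with hc
  have hperp : inner ℝ a (b - c • a) = 0 := by
    rw [inner_sub_right, inner_smul_right, hc, div_mul_cancel₀ _ haa.ne', sub_self]
  have hb := key' _ hperp.le
  have hbc : b = c • a := by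
    have e : inner ℝ (b - c • a) (b - c • a) = inner ℝ b (b - c • a) := by
      conv_lhs => rw [inner_sub_left, inner_smul_left, hperp]
      simp
    exact sub_eq_zero.1 (real_inner_self_nonpos.1 (e.le.trans hb))
  have hcpos : 0 < c := by
    refine lt_of_le_of_ne ?_ fun h => hb0 (by rw [hbc, ← h, zero_smul])
    have := key' (-a) (by rw [inner_neg_right]; linarith)
    rw [inner_neg_right, real_inner_comm] at this
    exact div_nonneg (by linarith) haa.le
  rw [hbc, norm_smul, Real.norm_of_nonneg hcpos.le, smul_smul, mul_inv, mul_right_comm,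
    inv_mul_cancel₀ hcpos.ne', one_mul]

theorem IsDefiningFunctionAt.outwardNormal_eq (hΩ : IsOpen Ω) (h : IsDefiningFunctionAt Ω x ψ)
    (hx : x ∈ frontier Ω) : outwardNormal Ω x = ‖gradient ψ x‖⁻¹ • gradient ψ x := by
  have hex : ∃ ψ : Space n → ℝ, IsDefiningFunctionAt Ω x ψ := ⟨ψ, h⟩
  rw [outwardNormal, dif_pos hex]
  exact hex.choose_spec.normalized_gradient_eq h (hex.choose_spec.eq_zero hΩ hx) (h.eq_zero hΩ hx)

theorem norm_outwardNormal_le (x : Space n) : ‖outwardNormal Ω x‖ ≤ 1 := by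
  rw [outwardNormal]
  split_ifs
  · rw [norm_smul, norm_inv, norm_norm]
    exact inv_mul_le_one
  · simp

/-- The normal is built from a defining function chosen separately at each point, but one `ψ` serves
all nearby boundary points and yields the same vector there. Continuity supplies the measurability
needed in the boundary integrals. -/
theorem IsSmoothBoundedDomain.continuousOn_outwardNormal (hΩ : IsSmoothBoundedDomain Ω) :
    ContinuousOn (outwardNormal Ω) (frontier Ω) := by
  intro x hx
  obtain ⟨ψ, hψ⟩ := hΩ.smooth_boundary x hx
  have hc : ContinuousAt (fun y => ‖gradient ψ y‖⁻¹ • gradient ψ y) x := by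
    have h1 := (continuous_gradient hψ.1).continuousAt (x := x)
    exact (h1.norm.inv₀ (norm_ne_zero_iff.2 hψ.2.1)).smul h1
  refine hc.continuousWithinAt.congr_of_eventuallyEq ?_ (hψ.outwardNormal_eq hΩ.isOpen hx)
  filter_upwards [self_mem_nhdsWithin, mem_nhdsWithin_of_mem_nhds hψ.eventually] with y hy hy'
  exact hy'.outwardNormal_eq hΩ.isOpen hy

theorem IsSmoothBoundedDomain.aestronglyMeasurable_outwardNormal (hΩ : IsSmoothBoundedDomain Ω)
    (T : ℝ) : AEStronglyMeasurable (fun z : Space n × ℝ => outwardNormal Ω z.1)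
      (lateralMeasure Ω T) := by
  have h : AEStronglyMeasurable (outwardNormal Ω) (surfaceMeasure Ω) :=
    hΩ.continuousOn_outwardNormal.aestronglyMeasurable isClosed_frontier.measurableSet
  exact h.comp_quasiMeasurePreserving Measure.quasiMeasurePreserving_fst

theorem ae_lateralMeasure_mem (Ω : Set (Space n)) (T : ℝ) :
    ∀ᵐ z ∂(lateralMeasure Ω T), z.1 ∈ frontier Ω ∧ z.2 ∈ Ioo 0 T := by
  have h1 : ∀ᵐ x ∂(surfaceMeasure Ω), x ∈ frontier Ω :=
    ae_restrict_mem isClosed_frontier.measurableSet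
  have h2 : ∀ᵐ t ∂(volume.restrict (Ioo 0 T)), t ∈ Ioo 0 T := ae_restrict_mem measurableSet_Ioo
  exact (Measure.quasiMeasurePreserving_fst.ae h1).and (Measure.quasiMeasurePreserving_snd.ae h2)

end HeatSource

namespace HeatSource

/-! ### The backward wave: its derivatives and exponential bounds. -/

section BackwardWave

variable {n : ℕ}

theorem contDiff_backwardWave (ω : Space n) (τ : ℝ) :
    ContDiff ℝ (⊤ : ℕ∞) (backwardWave ω τ) := by
  exact ((contDiff_const.mul (contDiff_fst.inner ℝ contDiff_const)).sub
    (contDiff_const.mul contDiff_snd)).exp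

theorem gradX_backwardWave (ω : Space n) (τ : ℝ) (z : Space n × ℝ) :
    gradX (backwardWave ω τ) z = (√τ * backwardWave ω τ z) • ω := by
  have h1 : HasFDerivAt (fun y : Space n => √τ * inner ℝ y ω - τ * z.2)
      (√τ • innerSL ℝ ω) z.1 := by
    have h0 : HasFDerivAt (fun y : Space n => inner ℝ ω y) (innerSL ℝ ω) z.1 :=
      (innerSL ℝ ω).hasFDerivAt
    simp only [real_inner_comm ω]
    exact (h0.const_mul √τ).sub_const _
  have h2 := h1.exp
  refine HasGradientAt.gradient (hasGradientAt_iff_hasFDerivAt.2 ?_)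
  have h3 : (InnerProductSpace.toDual ℝ (Space n)) ((√τ * backwardWave ω τ z) • ω) =
      Real.exp (√τ * inner ℝ z.1 ω - τ * z.2) • √τ • innerSL ℝ ω := by
    ext w
    simp [backwardWave]
    ring
  rw [h3]
  exact h2

theorem dtime_backwardWave (ω : Space n) (τ : ℝ) (z : Space n × ℝ) :
    dtime (backwardWave ω τ) z = -τ * backwardWave ω τ z := by
  have h1 : HasDerivAt (fun r : ℝ => √τ * inner ℝ z.1 ω - τ * r) (-τ) z.2 := by
    simpa using ((hasDerivAt_id z.2).const_mul τ).const_sub (√τ * inner ℝ z.1 ω)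
  rw [dtime, backwardWave, mul_comm]
  exact h1.exp.deriv

/-- The wave vector `√τ ω` has squared length `τ`, so `Δv = τ v` cancels `v_t = -τ v`. -/
theorem divX_gradX_backwardWave {ω : Space n} (hω : ‖ω‖ = 1) {τ : ℝ} (hτ : 0 ≤ τ)
    (z : Space n × ℝ) :
    divX (gradX (backwardWave ω τ)) z = τ * backwardWave ω τ z := by
  have hd : DifferentiableAt ℝ (fun y => backwardWave ω τ (y, z.2)) z.1 :=
    ((contDiff_backwardWave ω τ).comp (contDiff_id.prodMk contDiff_const)).differentiable
      (by simp) z.1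
  have h1 : HasFDerivAt (fun y => gradX (backwardWave ω τ) (y, z.2))
      ((√τ • fderiv ℝ (fun y => backwardWave ω τ (y, z.2)) z.1).smulRight ω) z.1 := by
    simp only [gradX_backwardWave]
    exact (hd.hasFDerivAt.const_mul √τ).smul_const ω
  have h2 : ∀ w, fderiv ℝ (fun y => backwardWave ω τ (y, z.2)) z.1 w =
      √τ * backwardWave ω τ z * inner ℝ ω w := by
    intro w
    rw [← inner_gradient_left, ← real_inner_smul_left]
    exact congrArg (inner ℝ · w) (gradX_backwardWave ω τ z)
  have h3 : ∑ i, ω i * ω i = 1 := by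
    have := EuclideanSpace.real_norm_sq_eq ω
    rw [hω] at this
    simpa [sq] using this.symm
  rw [divX, h1.fderiv]
  simp only [ContinuousLinearMap.smulRight_apply, _root_.smul_apply, h2, smul_eq_mul,
    PiLp.smul_apply, EuclideanSpace.inner_single_right]
  calc _ = ∑ i, √τ * √τ * backwardWave ω τ z * (ω i * ω i) :=
        Finset.sum_congr rfl fun i _ => by simp; ring
    _ = _ := by rw [← Finset.mul_sum, h3, Real.mul_self_sqrt hτ, mul_one]

theorem backwardWave_pos (ω : Space n) (τ : ℝ) (z : Space n × ℝ) : 0 < backwardWave ω τ z :=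
  Real.exp_pos _

theorem backwardWave_le {ω : Space n} (hω : ‖ω‖ = 1) {τ R t : ℝ} (hτ : 0 ≤ τ) {z : Space n × ℝ}
    (hR : ‖z.1‖ ≤ R) (ht : t ≤ z.2) : backwardWave ω τ z ≤ Real.exp (√τ * R - τ * t) := by
  have h1 : inner ℝ z.1 ω ≤ R :=
    (real_inner_le_norm _ _).trans (by rw [hω, mul_one]; exact hR)
  refine Real.exp_le_exp.2 (sub_le_sub ?_ ?_)
  · exact mul_le_mul_of_nonneg_left h1 (Real.sqrt_nonneg _)
  · exact mul_le_mul_of_nonneg_left ht hτ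

theorem le_backwardWave {ω : Space n} (hω : ‖ω‖ = 1) {τ R t : ℝ} (hτ : 0 ≤ τ) {z : Space n × ℝ}
    (hR : ‖z.1‖ ≤ R) (ht : z.2 ≤ t) : Real.exp (-(√τ * R) - τ * t) ≤ backwardWave ω τ z := by
  have h1 : -R ≤ inner ℝ z.1 ω := by
    have := (abs_le.1 (abs_real_inner_le_norm z.1 ω)).1
    rw [hω, mul_one] at this
    linarith
  refine Real.exp_le_exp.2 (sub_le_sub ?_ ?_)
  · rw [← mul_neg]
    exact mul_le_mul_of_nonneg_left h1 (Real.sqrt_nonneg _)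
  · exact mul_le_mul_of_nonneg_left ht hτ

end BackwardWave

/-! ### The integral identity for the indicator function. -/

section Identity

variable {n : ℕ} {Ω : Set (Space n)}

theorem IsSmoothBoundedDomain.exists_norm_le (hΩ : IsSmoothBoundedDomain Ω) :
    ∃ R, ∀ x ∈ closure Ω, ‖x‖ ≤ R :=
  hΩ.isBounded.closure.exists_norm_le

/-- Integration by parts: the lateral Cauchy data determine the source tested with the backward
wave, up to a contribution of the final time. -/
theorem IsWeakSolution.indicatorFunction_zero (hΩ : IsSmoothBoundedDomain Ω) {T : ℝ} (hT : 0 ≤ T)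
    {f u g h : Space n × ℝ → ℝ} (hu : IsWeakSolution Ω T f u g h) {ω : Space n} (hω : ‖ω‖ = 1)
    {τ : ℝ} (hτ : 0 ≤ τ) :
    indicatorFunction Ω T g h ω τ 0 =
      (∫ z in cylinder Ω T, f z * backwardWave ω τ z)
        - ∫ x in Ω, u (x, T) * backwardWave ω τ (x, T) := by
  obtain ⟨R, hR⟩ := hΩ.exists_norm_le
  obtain ⟨Du, -, -, htr, hweak⟩ := hu.weak_form
  have hsmooth := contDiff_backwardWave ω τ
  have htr := htr (gradX (backwardWave ω τ)) (by
    have : gradX (backwardWave ω τ) = fun z => (√τ * backwardWave ω τ z) • ω :=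
      funext (gradX_backwardWave ω τ)
    rw [this]
    exact (contDiff_const.mul hsmooth).smul contDiff_const)
  have hweak := hweak (backwardWave ω τ) hsmooth T ⟨hT, le_rfl⟩
  have heq : ∀ z, inner ℝ (Du z) (gradX (backwardWave ω τ) z) - u z * dtime (backwardWave ω τ) z =
      u z * divX (gradX (backwardWave ω τ)) z + inner ℝ (Du z) (gradX (backwardWave ω τ) z) := by
    intro z
    rw [dtime_backwardWave, divX_gradX_backwardWave hω hτ]
    ring
  have hbound : ∀ᵐ z ∂(lateralMeasure Ω T), backwardWave ω τ z ≤ Real.exp (√τ * R - τ * 0) := by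
    filter_upwards [ae_lateralMeasure_mem Ω T] with z hz
    exact backwardWave_le hω hτ (hR _ (frontier_subset_closure hz.1)) hz.2.1.le
  -- The two boundary terms must be integrable separately for the integral to split; `v` and `∇v`
  -- are bounded on the lateral boundary and the data are integrable.
  have hint1 : Integrable (fun z => inner ℝ (gradX (backwardWave ω τ) z) (outwardNormal Ω z.1) * g z)
      (lateralMeasure Ω T) := by
    refine hu.integrable_trace.bdd_mul (c := √τ * Real.exp (√τ * R - τ * 0)) ?_ ?_
    · simp only [gradX_backwardWave]
      refine AEStronglyMeasurable.inner ?_ (hΩ.aestronglyMeasurable_outwardNormal T)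
      exact ((continuous_const.mul hsmooth.continuous).smul
        continuous_const).aestronglyMeasurable
    · filter_upwards [hbound] with z hz
      refine (norm_inner_le_norm _ _).trans ?_
      rw [gradX_backwardWave, norm_smul, hω, mul_one, Real.norm_of_nonneg
        (mul_nonneg (Real.sqrt_nonneg _) (backwardWave_pos ω τ z).le)]
      refine (mul_le_of_le_one_right ?_ (norm_outwardNormal_le _)).trans ?_
      · exact mul_nonneg (Real.sqrt_nonneg _) (backwardWave_pos ω τ z).le
      · exact mul_le_mul_of_nonneg_left hz (Real.sqrt_nonneg _)
  have hint2 : Integrable (fun z => h z * backwardWave ω τ z) (lateralMeasure Ω T) := by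
    refine hu.integrable_normal.mul_bdd (c := Real.exp (√τ * R - τ * 0))
      hsmooth.continuous.aestronglyMeasurable ?_
    filter_upwards [hbound] with z hz
    rwa [Real.norm_of_nonneg (backwardWave_pos ω τ z).le]
  rw [indicatorFunction, mul_zero, Real.exp_zero, one_mul, integral_sub hint1 hint2]
  simp only [heq] at hweak
  simp only [mul_comm _ (g _)]
  rw [htr]
  linarith

end Identity

/-! ### From exponential bounds to the logarithmic rate and the threshold in `s`. -/

section Asymptotics

theorem tendsto_sqrt_div_self : Tendsto (fun τ : ℝ => √τ / τ) atTop (𝓝 0) := by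
  simp only [Real.sqrt_div_self]
  exact Real.tendsto_sqrt_atTop.inv_tendsto_atTop

/-- Two-sided exponential bounds determine the exponential rate of decay. -/
theorem tendsto_log_abs_div_of_exp_bounds {I : ℝ → ℝ} {T₀ δ R A : ℝ} (hδ : 0 < δ)
    (hub : ∀ τ > 0, |I τ| ≤ A * Real.exp (√τ * R - τ * T₀))
    (hlb : ∀ ε ∈ Ioo 0 δ, ∃ a > 0, ∃ B : ℝ, ∀ τ > 0,
      a * Real.exp (-(√τ * R) - τ * (T₀ + ε)) - B * Real.exp (√τ * R - τ * (T₀ + δ)) ≤ |I τ|) :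
    (∀ᶠ τ in atTop, I τ ≠ 0) ∧
      Tendsto (fun τ => Real.log |I τ| / τ) atTop (𝓝 (-T₀)) := by
  have hinv : ∀ c : ℝ, Tendsto (fun τ : ℝ => c / τ) atTop (𝓝 0) := fun c =>
    tendsto_const_nhds.div_atTop tendsto_id
  have hsq : Tendsto (fun τ : ℝ => R * (√τ / τ)) atTop (𝓝 0) := by
    simpa using tendsto_sqrt_div_self.const_mul R
  have hlow : ∀ ε ∈ Ioo 0 δ, ∃ a > 0, ∀ᶠ τ in atTop,
      a * Real.exp (-(√τ * R) - τ * (T₀ + ε)) ≤ |I τ| := by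
    intro ε hε
    obtain ⟨a, ha, B, hB⟩ := hlb ε hε
    -- This is the exponent `2√τ R - τ(δ - ε)` of the ratio of error to main term.
    have h1 : Tendsto (fun τ : ℝ => τ * (2 * (R * (√τ / τ)) - (δ - ε))) atTop atBot := by
      refine tendsto_id.atTop_mul_neg (C := 2 * 0 - (δ - ε)) (by linarith [hε.2]) ?_
      exact (hsq.const_mul 2).sub_const _
    have h2 : Tendsto (fun τ : ℝ => B * Real.exp (τ * (2 * (R * (√τ / τ)) - (δ - ε)))) atTop
        (𝓝 0) := by
      simpa using (Real.tendsto_exp_atBot.comp h1).const_mul B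
    refine ⟨a / 2, half_pos ha, ?_⟩
    filter_upwards [h2.eventually_le_const (half_pos ha), eventually_gt_atTop 0] with τ hτ hτ0
    refine le_trans ?_ (hB τ hτ0)
    have e : Real.exp (√τ * R - τ * (T₀ + δ)) =
        Real.exp (τ * (2 * (R * (√τ / τ)) - (δ - ε))) *
          Real.exp (-(√τ * R) - τ * (T₀ + ε)) := by
      rw [← Real.exp_add]
      congr 1
      field_simp
      ring
    rw [e, ← mul_assoc, ← sub_mul]
    exact mul_le_mul_of_nonneg_right (by linarith) (Real.exp_pos _).le
  have hne : ∀ᶠ τ in atTop, 0 < |I τ| := by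
    obtain ⟨a, ha, hI⟩ := hlow (δ / 2) ⟨half_pos hδ, half_lt_self hδ⟩
    filter_upwards [hI] with τ hτ
    exact (by positivity : 0 < a * Real.exp (-(√τ * R) - τ * (T₀ + δ / 2))).trans_le hτ
  refine ⟨hne.mono fun τ hτ => abs_pos.1 hτ, tendsto_order.2 ⟨fun b hb => ?_, fun b hb => ?_⟩⟩
  -- Bounding `ε` by `-T₀ - b` keeps the lower rate `-(T₀ + ε)` above `b`.
  · obtain ⟨ε, hε0, hε⟩ := exists_between (lt_min hδ (by linarith : 0 < -T₀ - b))
    obtain ⟨a, ha, hI⟩ := hlow ε ⟨hε0, hε.trans_le (min_le_left _ _)⟩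
    have hlim : Tendsto (fun τ : ℝ => Real.log a / τ - R * (√τ / τ) - (T₀ + ε)) atTop
        (𝓝 (0 - 0 - (T₀ + ε))) := ((hinv _).sub hsq).sub_const _
    have hb' : b < 0 - 0 - (T₀ + ε) := by linarith [hε.trans_le (min_le_right _ _)]
    filter_upwards [hI, hlim.eventually_const_lt hb', eventually_gt_atTop 0] with τ h1 h2 h3
    refine h2.trans_le ?_
    rw [le_div_iff₀ h3]
    have h4 := Real.log_le_log (by positivity) h1
    rw [Real.log_mul ha.ne' (Real.exp_pos _).ne', Real.log_exp] at h4
    refine le_trans (le_of_eq ?_) h4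
    field_simp
    ring
  · have hlim : Tendsto (fun τ : ℝ => Real.log A / τ + R * (√τ / τ) - T₀) atTop
        (𝓝 (0 + 0 - T₀)) := ((hinv _).add hsq).sub_const _
    have hb' : 0 + 0 - T₀ < b := by linarith
    filter_upwards [hne, hlim.eventually_lt_const hb', eventually_gt_atTop 0] with τ h1 h2 h3
    refine lt_of_le_of_lt ?_ h2
    rw [div_le_iff₀ h3]
    have h4 := hub τ h3
    have hA : 0 < A := pos_of_mul_pos_left (h1.trans_le h4) (Real.exp_pos _).le
    have h5 := Real.log_le_log h1 h4
    rw [Real.log_mul hA.ne' (Real.exp_pos _).ne', Real.log_exp] at h5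
    refine h5.trans (le_of_eq ?_)
    field_simp
    ring

variable {I : ℝ → ℝ} {T₀ : ℝ}

theorem eventually_exp_mul_abs_eq (hI : ∀ᶠ τ in atTop, I τ ≠ 0) (s : ℝ) :
    ∀ᶠ τ in atTop, Real.exp (τ * (s + Real.log |I τ| / τ)) = Real.exp (τ * s) * |I τ| := by
  filter_upwards [hI, eventually_gt_atTop 0] with τ h1 h2
  rw [mul_add, mul_div_cancel₀ _ h2.ne', Real.exp_add, Real.exp_log (abs_pos.2 h1)]

theorem tendsto_exp_mul_abs_zero (hI : ∀ᶠ τ in atTop, I τ ≠ 0)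
    (hlim : Tendsto (fun τ => Real.log |I τ| / τ) atTop (𝓝 (-T₀))) {s : ℝ} (hs : s < T₀) :
    Tendsto (fun τ => Real.exp (τ * s) * |I τ|) atTop (𝓝 0) := by
  refine Tendsto.congr' (eventually_exp_mul_abs_eq hI s) (Real.tendsto_exp_atBot.comp ?_)
  exact tendsto_id.atTop_mul_neg (by linarith : s + -T₀ < 0) (hlim.const_add s)

theorem tendsto_exp_mul_abs_atTop (hI : ∀ᶠ τ in atTop, I τ ≠ 0)
    (hlim : Tendsto (fun τ => Real.log |I τ| / τ) atTop (𝓝 (-T₀))) {s : ℝ} (hs : T₀ < s) :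
    Tendsto (fun τ => Real.exp (τ * s) * |I τ|) atTop atTop := by
  refine Tendsto.congr' (eventually_exp_mul_abs_eq hI s) (Real.tendsto_exp_atTop.comp ?_)
  exact tendsto_id.atTop_mul_pos (by linarith : 0 < s + -T₀) (hlim.const_add s)

end Asymptotics

end HeatSource

/-! ### Estimates of the source and final-time terms. -/

namespace HeatSource

variable {n : ℕ} {Ω : Set (Space n)} {D : Set (Space n × ℝ)} {ρ : Space n × ℝ → ℝ}
  {T T₀ δ ε : ℝ}

theorem exists_abs_le_of_memLp_top (hD : NullMeasurableSet D volume)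
    (hρ : MemLp ρ ∞ (volume.restrict D)) :
    ∃ K, 0 ≤ K ∧ ∀ᵐ z, |D.indicator ρ z| ≤ K := by
  refine ⟨(eLpNorm ρ ∞ (volume.restrict D)).toReal, ENNReal.toReal_nonneg, ?_⟩
  have h1 : ∀ᵐ z ∂(volume.restrict D), ‖ρ z‖ₑ ≤ eLpNorm ρ ∞ (volume.restrict D) := by
    rw [eLpNorm_exponent_top]
    exact ae_le_eLpNormEssSup
  filter_upwards [(ae_restrict_iff'₀ hD).1 h1] with z hz
  by_cases hzD : z ∈ D
  · rw [indicator_of_mem hzD, ← Real.norm_eq_abs, ← toReal_enorm]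
    exact ENNReal.toReal_mono hρ.2.ne (hz hzD)
  · rw [indicator_of_notMem hzD, abs_zero]
    exact ENNReal.toReal_nonneg

theorem measurableSet_cylinder (hΩ : IsOpen Ω) (T : ℝ) : MeasurableSet (cylinder Ω T) :=
  hΩ.measurableSet.prod measurableSet_Ioo

theorem volume_cylinder_lt_top (hΩ : Bornology.IsBounded Ω) (T : ℝ) :
    volume (cylinder Ω T) < ∞ := by
  rw [cylinder, Measure.volume_eq_prod, Measure.prod_prod]
  exact ENNReal.mul_lt_top hΩ.measure_lt_top (by simp)

/-- A set whose cross-sections just after the time `T₀` are not null carries mass just after `T₀`. -/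
theorem volume_inter_slab_ne_zero
    (hsection : ∀ᵐ s : ℝ, s ∈ Ioc 0 ε → volume {x : Space n | (x, T₀ + s) ∈ D} ≠ 0)
    (hε : 0 < ε) : volume (D ∩ univ ×ˢ Icc T₀ (T₀ + ε)) ≠ 0 := by
  intro h0
  have h1 : ∀ᵐ z ∂((volume : Measure (Space n)).prod (volume : Measure ℝ)),
      z ∉ D ∩ univ ×ˢ Icc T₀ (T₀ + ε) := measure_eq_zero_iff_ae_notMem.1 h0
  -- Fubini with time as the outer variable, then a shift by `T₀`: if the slab were null, almost
  -- every cross-section would be null, so `Ioc 0 ε` would have length zero.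
  have h2 := (Measure.measurePreserving_swap (μ := (volume : Measure ℝ))
    (ν := (volume : Measure (Space n)))).quasiMeasurePreserving.ae h1
  have h3 := (quasiMeasurePreserving_add_left volume T₀).ae (Measure.ae_ae_of_ae_prod h2)
  have h4 : ∀ᵐ s : ℝ, s ∉ Ioc 0 ε := by
    filter_upwards [h3, hsection] with s hs hs' hsε
    refine hs' hsε (measure_eq_zero_iff_ae_notMem.2 ?_)
    filter_upwards [hs] with x hx hxD
    exact hx ⟨hxD, mem_univ _, by simp [hsε.1.le], by simp [hsε.2]⟩
  have h5 := measure_eq_zero_iff_ae_notMem.2 h4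
  simp [hε.not_ge] at h5

/-- `D` may meet the lateral boundary and, if `T₀ = 0`, the initial time, neither of which is in the
open cylinder; both are null. The final time is avoided by `T₀ + ε < T`. -/
theorem volume_inter_cylinder_ne_zero (hΩ : IsSmoothBoundedDomain Ω) (hT₀ : 0 ≤ T₀)
    (hDsub : D ⊆ closure Ω ×ˢ Icc T₀ T) (hε : T₀ + ε < T)
    (h : volume (D ∩ univ ×ˢ Icc T₀ (T₀ + ε)) ≠ 0) :
    volume (D ∩ univ ×ˢ Icc T₀ (T₀ + ε) ∩ cylinder Ω T) ≠ 0 := by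
  intro h0
  refine h (measure_mono_null (t := D ∩ univ ×ˢ Icc T₀ (T₀ + ε) ∩ cylinder Ω T ∪
    (frontier Ω ×ˢ univ ∪ univ ×ˢ {0})) ?_ ?_)
  · rintro ⟨x, t⟩ hz
    have hx := (hDsub hz.1).1
    have ht := hz.2.2
    simp only [mem_Icc] at hx ht
    by_cases hxΩ : x ∈ Ω
    · rcases eq_or_lt_of_le (hT₀.trans ht.1) with h0 | h0
      · exact Or.inr (Or.inr ⟨mem_univ _, h0.symm⟩)
      · exact Or.inl ⟨hz, hxΩ, h0, ht.2.trans_lt hε⟩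
    · exact Or.inr (Or.inl ⟨by rw [hΩ.isOpen.frontier_eq]; exact ⟨hx, hxΩ⟩, mem_univ _⟩)
  · refine measure_union_null h0 (measure_union_null ?_ ?_)
    · rw [Measure.volume_eq_prod, Measure.prod_prod, hΩ.volume_frontier, zero_mul]
    · rw [Measure.volume_eq_prod, Measure.prod_prod, Real.volume_singleton, mul_zero]

variable {ω : Space n} {R : ℝ}

theorem abs_setIntegral_source_mul_backwardWave_le (hΩ : IsSmoothBoundedDomain Ω)
    (hR : ∀ x ∈ closure Ω, ‖x‖ ≤ R) (hω : ‖ω‖ = 1) (hDsub : D ⊆ closure Ω ×ˢ Icc T₀ T)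
    {K : ℝ} (hK0 : 0 ≤ K) (hK : ∀ᵐ z, |D.indicator ρ z| ≤ K) {τ : ℝ} (hτ : 0 ≤ τ) :
    |∫ z in cylinder Ω T, D.indicator ρ z * backwardWave ω τ z| ≤
      K * volume.real (cylinder Ω T) * Real.exp (√τ * R - τ * T₀) := by
  have h := norm_setIntegral_le_of_norm_le_const_ae' (μ := volume) (s := cylinder Ω T)
    (f := fun z => D.indicator ρ z * backwardWave ω τ z) (C := K * Real.exp (√τ * R - τ * T₀))
    (volume_cylinder_lt_top hΩ.isBounded T) (by
      filter_upwards [hK] with z hz hzc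
      by_cases hzD : z ∈ D
      · rw [norm_mul, Real.norm_of_nonneg (backwardWave_pos ω τ z).le]
        exact mul_le_mul hz (backwardWave_le hω hτ (hR _ (subset_closure hzc.1)) (hDsub hzD).2.1)
          (backwardWave_pos ω τ z).le hK0
      · rw [indicator_of_notMem hzD, zero_mul, norm_zero]
        positivity)
  rw [Real.norm_eq_abs] at h
  exact h.trans_eq (mul_right_comm _ _ _)

theorem abs_setIntegral_mul_backwardWave_le (hΩ : IsSmoothBoundedDomain Ω)
    (hR : ∀ x ∈ closure Ω, ‖x‖ ≤ R) (hω : ‖ω‖ = 1) {w : Space n → ℝ}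
    (hw : MemLp w 2 (volume.restrict Ω)) {τ : ℝ} (hτ : 0 ≤ τ) (t : ℝ) :
    |∫ x in Ω, w x * backwardWave ω τ (x, t)| ≤
      (∫ x in Ω, ‖w x‖) * Real.exp (√τ * R - τ * t) := by
  have : IsFiniteMeasure (volume.restrict Ω) := ⟨by
    rw [Measure.restrict_apply_univ]; exact hΩ.isBounded.measure_lt_top⟩
  have hwi : Integrable w (volume.restrict Ω) := hw.integrable (by norm_num)
  rw [← Real.norm_eq_abs, ← integral_mul_const]
  refine norm_integral_le_of_norm_le (hwi.norm.mul_const _) ?_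
  filter_upwards [ae_restrict_mem hΩ.isOpen.measurableSet] with x hx
  rw [norm_mul, Real.norm_of_nonneg (backwardWave_pos ω τ _).le]
  exact mul_le_mul_of_nonneg_left (backwardWave_le hω hτ (hR _ (subset_closure hx)) le_rfl)
    (norm_nonneg _)

theorem le_mul_setIntegral_source_mul_backwardWave (hΩ : IsSmoothBoundedDomain Ω)
    (hR : ∀ x ∈ closure Ω, ‖x‖ ≤ R) (hω : ‖ω‖ = 1) (hD : NullMeasurableSet D volume)
    (hDsub : D ⊆ closure Ω ×ˢ Icc T₀ T) (hρ : MemLp ρ ∞ (volume.restrict D))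
    {K : ℝ} (hK0 : 0 ≤ K) (hK : ∀ᵐ z, |D.indicator ρ z| ≤ K) {C σ : ℝ} (hC : 0 < C)
    (hσ : |σ| = 1) (hsign : ∀ᵐ z, z ∈ D → z.2 ∈ Icc T₀ (T₀ + δ) → C ≤ σ * ρ z)
    (hεδ : ε ≤ δ) {τ : ℝ} (hτ : 0 ≤ τ) :
    C * volume.real (D ∩ univ ×ˢ Icc T₀ (T₀ + ε) ∩ cylinder Ω T) *
        Real.exp (-(√τ * R) - τ * (T₀ + ε)) -
      K * volume.real (cylinder Ω T) * Real.exp (√τ * R - τ * (T₀ + δ)) ≤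
      σ * ∫ z in cylinder Ω T, D.indicator ρ z * backwardWave ω τ z := by
  set A := D ∩ univ ×ˢ Icc T₀ (T₀ + ε) with hA
  have hAm : NullMeasurableSet A volume :=
    hD.inter (MeasurableSet.univ.prod measurableSet_Icc).nullMeasurableSet
  have hAm' : NullMeasurableSet A (volume.restrict (cylinder Ω T)) :=
    hAm.mono_ac Measure.restrict_le_self.absolutelyContinuous
  have hcm := measurableSet_cylinder hΩ.isOpen T
  have hcfin := volume_cylinder_lt_top hΩ.isBounded T
  have : IsFiniteMeasure (volume.restrict (cylinder Ω T)) := ⟨by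
    rwa [Measure.restrict_apply_univ]⟩
  have hpos : ∀ z, 0 < backwardWave ω τ z := backwardWave_pos ω τ
  have hint : Integrable (fun z => σ * (D.indicator ρ z * backwardWave ω τ z))
      (volume.restrict (cylinder Ω T)) := by
    refine Integrable.const_mul ?_ _
    refine Integrable.of_bound (C := K * Real.exp (√τ * R - τ * 0)) ?_ ?_
    · refine AEStronglyMeasurable.mul ?_
        (contDiff_backwardWave ω τ).continuous.aestronglyMeasurable
      exact ((aestronglyMeasurable_indicator_iff₀ hD).2 hρ.1).mono_ac
        Measure.restrict_le_self.absolutelyContinuous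
    · filter_upwards [ae_restrict_of_ae hK, ae_restrict_mem hcm] with z hz hzc
      rw [norm_mul, Real.norm_of_nonneg (hpos z).le]
      exact mul_le_mul hz (backwardWave_le hω hτ (hR _ (subset_closure hzc.1)) hzc.2.1.le)
        (hpos z).le hK0
  set c₁ := Real.exp (-(√τ * R) - τ * (T₀ + ε))
  set c₂ := Real.exp (√τ * R - τ * (T₀ + δ))
  have hint₁ : Integrable (A.indicator fun _ => C * c₁) (volume.restrict (cylinder Ω T)) :=
    (integrable_const _).indicator₀ hAm'
  -- Pointwise, `σ f v ≥ C c₁ 1_A - K c₂`: on `A` by the sign condition, on `D` outside `A` up to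
  -- time `T₀ + δ` because `σ f v ≥ 0`, and later because `|f v| ≤ K c₂`.
  have hle := integral_mono_ae (hint₁.sub (integrable_const (K * c₂))) hint (by
    filter_upwards [ae_restrict_of_ae hK, ae_restrict_of_ae hsign, ae_restrict_mem hcm]
      with z hz hzs hzc
    have hzR := hR _ (subset_closure hzc.1)
    have hKc : 0 ≤ K * c₂ := by positivity
    simp only [Pi.sub_apply]
    by_cases hzD : z ∈ D
    · rw [indicator_of_mem hzD ρ] at hz ⊢
      rcases le_or_gt z.2 (T₀ + δ) with hzt | hzt
      · have hzs := hzs hzD ⟨(hDsub hzD).2.1, hzt⟩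
        have h1 : 0 ≤ σ * (ρ z * backwardWave ω τ z) := by
          rw [← mul_assoc]
          exact mul_nonneg (hC.le.trans hzs) (hpos z).le
        by_cases hzA : z ∈ A
        · rw [indicator_of_mem hzA]
          have h2 : C * c₁ ≤ σ * ρ z * backwardWave ω τ z :=
            mul_le_mul hzs (le_backwardWave hω hτ hzR hzA.2.2.2) (Real.exp_pos _).le
              (hC.le.trans hzs)
          linarith
        · rw [indicator_of_notMem hzA]
          linarith
      · have hzA : z ∉ A := fun h => by linarith [h.2.2.2]
        rw [indicator_of_notMem hzA, zero_sub]
        refine neg_le_of_abs_le ?_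
        rw [abs_mul, hσ, one_mul, abs_mul, abs_of_pos (hpos z)]
        exact mul_le_mul hz (backwardWave_le hω hτ hzR hzt.le) (hpos z).le hK0
    · have hzA : z ∉ A := fun h => hzD h.1
      rw [indicator_of_notMem hzD, indicator_of_notMem hzA]
      linarith)
  rw [integral_const_mul] at hle
  refine le_trans (le_of_eq ?_) hle
  rw [integral_sub' hint₁ (integrable_const _), integral_indicator₀ hAm']
  simp only [integral_const, smul_eq_mul, measureReal_restrict_apply_univ]
  have hA_real : (volume.restrict (cylinder Ω T)).real A = volume.real (A ∩ cylinder Ω T) := by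
    rw [measureReal_def, Measure.restrict_apply' hcm, measureReal_def]
  rw [hA_real]
  ring

end HeatSource

/-! ### Assembly of the main theorem. -/

theorem theorem2p1 {n : ℕ} (hn : 1 ≤ n) (hn3 : n ≤ 3)
    (Ω : Set (HeatSource.Space n)) (hΩ : HeatSource.IsSmoothBoundedDomain Ω)
    (T T₀ : ℝ) (hT₀ : 0 ≤ T₀) (hT : T₀ < T)
    -- the source `f = χ_D ρ`
    (D : Set (HeatSource.Space n × ℝ)) (hD : NullMeasurableSet D volume)
    (hDsub : D ⊆ closure Ω ×ˢ Icc T₀ T)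
    (ρ : HeatSource.Space n × ℝ → ℝ) (hρ : MemLp ρ ∞ (volume.restrict D))
    -- its behaviour just after the time `T₀`
    (δ C₁ C₂ p : ℝ) (hδ : 0 < δ) (hδT : δ < T - T₀) (hC₁ : 0 < C₁) (hC₂ : 0 < C₂) (hp : 0 ≤ p)
    (hsection : ∀ᵐ s : ℝ, s ∈ Icc 0 δ →
      ENNReal.ofReal (C₁ * s ^ p) ≤ volume {x : HeatSource.Space n | (x, T₀ + s) ∈ D})
    (hsign :
      (∀ᵐ z : HeatSource.Space n × ℝ, z ∈ D → z.2 ∈ Icc T₀ (T₀ + δ) → C₂ ≤ ρ z) ∨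
      (∀ᵐ z : HeatSource.Space n × ℝ, z ∈ D → z.2 ∈ Icc T₀ (T₀ + δ) → C₂ ≤ -ρ z))
    -- the temperature `u` and its lateral Cauchy data `g = u`, `h = ∂u/∂ν`
    (u g h : HeatSource.Space n × ℝ → ℝ)
    (hu : HeatSource.IsWeakSolution Ω T (D.indicator ρ) u g h)
    (ω : HeatSource.Space n) (hω : ‖ω‖ = 1) :
    (∀ᶠ τ : ℝ in atTop, HeatSource.indicatorFunction Ω T g h ω τ 0 ≠ 0) ∧
    Tendsto (fun τ : ℝ => Real.log |HeatSource.indicatorFunction Ω T g h ω τ 0| / τ)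
      atTop (𝓝 (-T₀)) ∧
    (∀ s : ℝ, s < T₀ →
      Tendsto (fun τ : ℝ => |HeatSource.indicatorFunction Ω T g h ω τ s|) atTop (𝓝 0)) ∧
    (∀ s : ℝ, T₀ < s →
      Tendsto (fun τ : ℝ => |HeatSource.indicatorFunction Ω T g h ω τ s|) atTop atTop) := by
  obtain ⟨R, hR⟩ := hΩ.exists_norm_le
  obtain ⟨K, hK0, hK⟩ := HeatSource.exists_abs_le_of_memLp_top hD hρ
  obtain ⟨σ, hσ, hσsign⟩ : ∃ σ : ℝ, |σ| = 1 ∧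
      ∀ᵐ z : HeatSource.Space n × ℝ, z ∈ D → z.2 ∈ Icc T₀ (T₀ + δ) → C₂ ≤ σ * ρ z := by
    rcases hsign with h | h
    · exact ⟨1, abs_one, by simpa using h⟩
    · exact ⟨-1, by simp, by simpa using h⟩
  have hT0 : 0 ≤ T := hT₀.trans hT.le
  have hI := fun {τ : ℝ} (hτ : 0 ≤ τ) => hu.indicatorFunction_zero hΩ hT0 hω hτ
  have hF := fun {τ : ℝ} (hτ : 0 ≤ τ) =>
    HeatSource.abs_setIntegral_source_mul_backwardWave_le hΩ hR hω hDsub hK0 hK hτ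
  set M := ∫ x in Ω, ‖u (x, T)‖ with hM
  have hM0 : 0 ≤ M := integral_nonneg fun x => norm_nonneg _
  -- The decay `e^{-τT}` is weakened to `e^{-τt}`: `t = T₀` serves the upper bound, `t = T₀ + δ` the
  -- lower one.
  have hE := fun {τ : ℝ} (hτ : 0 ≤ τ) {t : ℝ} (ht : t ≤ T) =>
    (HeatSource.abs_setIntegral_mul_backwardWave_le hΩ hR hω
      (hu.memLp_time T ⟨hT0, le_rfl⟩) hτ T).trans
      (mul_le_mul_of_nonneg_left (Real.exp_le_exp.2
        (sub_le_sub_left (mul_le_mul_of_nonneg_left ht hτ) (√τ * R))) hM0)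
  obtain ⟨hne, hlim⟩ := HeatSource.tendsto_log_abs_div_of_exp_bounds
    (I := fun τ => HeatSource.indicatorFunction Ω T g h ω τ 0) (T₀ := T₀) (R := R)
    (A := K * volume.real (HeatSource.cylinder Ω T) + M) hδ
    (by
      intro τ hτ
      simp only [hI hτ.le]
      refine (abs_sub _ _).trans ?_
      rw [add_mul]
      exact add_le_add (hF hτ.le) (hE hτ.le hT.le))
    (by
      intro ε hε
      -- `Ioc` drops `s = 0`, where `s ^ p` vanishes if `p > 0`.
      have hsec : ∀ᵐ s : ℝ, s ∈ Ioc 0 ε →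
          volume {x : HeatSource.Space n | (x, T₀ + s) ∈ D} ≠ 0 := by
        filter_upwards [hsection] with s hs hsε
        refine ((ENNReal.ofReal_pos.2 ?_).trans_le (hs ⟨hsε.1.le, hsε.2.trans hε.2.le⟩)).ne'
        exact mul_pos hC₁ (Real.rpow_pos_of_pos hsε.1 p)
      have hvol := HeatSource.volume_inter_cylinder_ne_zero hΩ hT₀ hDsub
        (by linarith [hε.2] : T₀ + ε < T) (HeatSource.volume_inter_slab_ne_zero hsec hε.1)
      have hvolpos := ENNReal.toReal_pos hvol
        ((measure_mono inter_subset_right).trans_lt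
          (HeatSource.volume_cylinder_lt_top hΩ.isBounded T)).ne
      -- The error constant collects the source after `T₀ + δ` and the final-time term `M`.
      refine ⟨_, mul_pos hC₂ hvolpos, K * volume.real (HeatSource.cylinder Ω T) + M, ?_⟩
      intro τ hτ
      have h1 := HeatSource.le_mul_setIntegral_source_mul_backwardWave hΩ hR hω hD hDsub hρ
        hK0 hK hC₂ hσ hσsign hε.2.le hτ.le
      have h2 := hE hτ.le (by linarith : T₀ + δ ≤ T)
      rw [measureReal_def] at h1
      simp only [hI hτ.le]
      set F := ∫ z in HeatSource.cylinder Ω T, D.indicator ρ z * HeatSource.backwardWave ω τ z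
      set E := ∫ x in Ω, u (x, T) * HeatSource.backwardWave ω τ (x, T)
      have h3 : σ * F ≤ |F| := (le_abs_self _).trans_eq (by rw [abs_mul, hσ, one_mul])
      have h4 := abs_sub_abs_le_abs_sub F E
      linarith)
  have habs : ∀ s τ : ℝ, |HeatSource.indicatorFunction Ω T g h ω τ s| =
      Real.exp (τ * s) * |HeatSource.indicatorFunction Ω T g h ω τ 0| := by
    intro s τ
    simp [HeatSource.indicatorFunction, abs_mul]
  refine ⟨hne, hlim, fun s hs => ?_, fun s hs => ?_⟩
  · exact (HeatSource.tendsto_exp_mul_abs_zero hne hlim hs).congr fun τ => (habs s τ).symm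
  · exact (HeatSource.tendsto_exp_mul_abs_atTop hne hlim hs).congr fun τ => (habs s τ).symm
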